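/- Let $m,n$ be positive integers and let $G$ be a finite $(2,m,n)$-group; that is, $G$ is a finite group generated by two elements $g,h$ of orders $m$ and $n$ respectively with $(gh)^2=1$. Let $$\chi=|G|\left(\frac1m-\frac12+\frac1n\right)$$ be its Euler characteristic. Suppose that $G$ is not solvable and that $\chi$ is divisible by exactly two primes, $2$ and $s$ (so $s$ is an odd prime). Let $O_{2,s}(G)$ be the largest normal subgroup of $G$ whose order is of the form $2^as^b$ with integers $a,b\ge 0$, and write $\overline{G}=G/O_{2,s}(G)$. Then there are a positive integer $k$, a group $M$ and groups $T_1,\dots,T_k$ such that $\overline{G}$ has a normal subgroup $N$ isomorphic to $M\times T_1\times\cdots\times T_k$, where - $M$ is solvable, and its Fitting subgroup (the largest normal nilpotent subgroup of $M$) is cyclic of odd order; - $T_1,\dots,T_k$ are non-abelian simple groups; - for all $i\neq j$ we have $\gcd(|T_i|,|T_j|)=2^as^b$ for some integers $a,b\ge 0$ (depending on $i,j$); - $\overline{G}/N$ is isomorphic to a subgroup of $\mathrm{Out}(T_1\times\cdots\times T_k)$. -/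

import Mathlib

universe u

/-- `(G, g, h)` is a `(2, m, n)`-group: `m` and `n` are positive integers, `g` has order `m`,
`h` has order `n`, and `G` has a presentation
`⟨g, h ∣ g ^ m = h ^ n = (g h) ^ 2 = ⋯ = 1⟩` with possibly further relations, that is,
`g` and `h` generate `G` and `(g h) ^ 2 = 1` holds in `G`. -/
structure IsTwoMNGroup {G : Type*} [Group G] (m n : ℕ) (g h : G) : Prop where
  m_pos : 0 < m
  n_pos : 0 < n
  orderOf_left : orderOf g = m
  orderOf_right : orderOf h = n
  mul_sq : (g * h) ^ 2 = 1
  generate : Subgroup.closure {g, h} = ⊤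

/-- The Euler characteristic `χ = |G| (1/m - 1/2 + 1/n)` of a finite `(2, m, n)`-group. -/
noncomputable def twoMNEulerChar (G : Type*) [Group G] (m n : ℕ) : ℚ :=
  (Nat.card G : ℚ) * (1 / (m : ℚ) - 1 / 2 + 1 / (n : ℚ))

/-- The natural number `p` divides the rational number `x` in `ℤ`: `x` is an integer multiple
of `p` (in particular `x` is an integer). -/
def NatDvdRat (p : ℕ) (x : ℚ) : Prop :=
  ∃ k : ℤ, x = (p : ℚ) * (k : ℚ)

/-- `O_{p,q}(G)`: the join of all normal subgroups of `G` whose order is `p ^ a * q ^ b` for some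
`a b : ℕ`. For a finite group `G` and distinct primes `p`, `q` it is the largest such subgroup,
see `twoPrimeCore_isGreatest`. -/
def twoPrimeCore (p q : ℕ) (G : Type*) [Group G] : Subgroup G :=
  sSup {N : Subgroup G | N.Normal ∧ ∃ a b : ℕ, Nat.card N = p ^ a * q ^ b}

theorem sSup_normal_of_forall {G : Type*} [Group G] (S : Set (Subgroup G))
    (hS : ∀ N ∈ S, N.Normal) : (sSup S).Normal := by
  refine ⟨fun x hx y => ?_⟩
  have hle : sSup S ≤ (sSup S).comap (MulAut.conj y).toMonoidHom := by
    refine sSup_le fun N hN z hz => ?_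
    exact le_sSup hN ((hS N hN).conj_mem z hz y)
  exact hle hx

instance twoPrimeCore_normal (p q : ℕ) (G : Type*) [Group G] : (twoPrimeCore p q G).Normal :=
  sSup_normal_of_forall _ fun _ hN => hN.1

theorem twoPrimeCore_isGreatest {p q : ℕ} (hp : p.Prime) (hq : q.Prime)
    (G : Type*) [Group G] [Finite G] :
    IsGreatest {N : Subgroup G | N.Normal ∧ ∃ a b : ℕ, Nat.card N = p ^ a * q ^ b}
      (twoPrimeCore p q G) := by
  refine ⟨?_, fun N hN => le_sSup hN⟩
  have hsup : SupClosed {N : Subgroup G | N.Normal ∧ ∃ a b : ℕ, Nat.card N = p ^ a * q ^ b} := by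
    rintro H ⟨hHn, a, b, hH⟩ K ⟨hKn, c, d, hK⟩
    refine ⟨Subgroup.sup_normal H K, ?_⟩
    have h1 : Nat.card (H ⊔ K : Subgroup G) ∣ Nat.card H * Nat.card K := by
      have e := Nat.card_congr (QuotientGroup.quotientInfEquivProdNormalQuotient H K).toEquiv
      have e1 := Subgroup.card_eq_card_quotient_mul_card_subgroup (K.subgroupOf (H ⊔ K))
      have e2 : Nat.card (K.subgroupOf (H ⊔ K)) = Nat.card K :=
        Nat.card_congr (Subgroup.subgroupOfEquivOfLe le_sup_right).toEquiv
      rw [e1, e2, ← e]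
      exact Nat.mul_dvd_mul (Subgroup.card_quotient_dvd_card _) dvd_rfl
    have h2 : p ^ a * q ^ b * (p ^ c * q ^ d) = p ^ (a + c) * q ^ (b + d) := by ring
    rw [hH, hK, h2] at h1
    obtain ⟨x, y, hx, hy, hxy⟩ := exists_dvd_and_dvd_of_dvd_mul h1
    obtain ⟨i, -, rfl⟩ := (Nat.dvd_prime_pow hp).1 hx
    obtain ⟨j, -, rfl⟩ := (Nat.dvd_prime_pow hq).1 hy
    exact ⟨i, j, hxy⟩
  exact hsup.sSup_mem_of_nonempty (Set.toFinite _) ⟨⊥, inferInstance, 0, 0, by simp⟩ subset_rfl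

/-- The Fitting subgroup: the join of all normal nilpotent subgroups. -/
def fittingSubgroup (G : Type*) [Group G] : Subgroup G :=
  sSup {N : Subgroup G | N.Normal ∧ Group.IsNilpotent N}

/-- The inner automorphisms form a normal subgroup of the automorphism group. -/
instance innerAut_normal (G : Type*) [Group G] :
    (MulAut.conj : G →* MulAut G).range.Normal := by
  refine ⟨?_⟩
  rintro _ ⟨x, rfl⟩ φ
  refine ⟨φ x, ?_⟩
  ext y
  simp

/-- The outer automorphism group `Out(G) = Aut(G) / Inn(G)`. -/
abbrev OuterAut (G : Type*) [Group G] : Type _ :=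
  MulAut G ⧸ (MulAut.conj : G →* MulAut G).range

/-! The Euler characteristic enters only through one consequence: for every prime `p` other than `2`
and `s`, the `p`-subgroups of `G` are cyclic. Indeed `2χ = 2|G|/m - |G| + 2|G|/n`, and if a Sylow
`p`-subgroup is not cyclic, then no element has order divisible by the full `p`-part of `|G|`. So
`p` divides all three terms, hence `χ`.

Cyclicity passes to the quotient by `O_{2,s}(G)`. That core is solvable by Burnside's theorem, which
is proved here by characters, so the quotient is still not solvable, and its own core is trivial.
Let `D` be the last term of its derived series, a nontrivial perfect group, and let the `T i` be the
minimal normal subgroups of the quotient lying in `D`.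

Cyclicity forbids two commuting, disjoint subgroups whose orders share a prime other than `2` and
`s`. This makes each `T i` simple and gives the gcd condition. The `T i` are not abelian, because a
perfect group with cyclic Sylow `p`-subgroups has no central element of order `p` (transfer). Let
`E` be the product of the `T i` and `M` its centralizer. Then `M` meets `D` trivially, since
otherwise it would contain some `T i`; hence `M` embeds in the solvable quotient by `D`. Finally `N
= M × E`, and conjugation on `E` embeds the quotient by `N` in the outer automorphism group. -/

/-! ### Averages of roots of unity and traces. -/

/-- Every conjugate of `α` is again an average of roots of unity, so has absolute value at most 1.
By Kronecker's theorem `α` is a root of unity, and equality in the triangle inequality makes all the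
terms equal. -/
theorem eq_average_of_isIntegral_of_ne_zero {ι : Type*} [Fintype ι] {N : ℕ} (hN : 0 < N)
    (f : ι → ℂ) (hf : ∀ i, f i ^ N = 1) {α : ℂ} (hα : IsIntegral ℤ α) (hα0 : α ≠ 0)
    (hsum : (Fintype.card ι : ℂ) * α = ∑ i, f i) (i : ι) : f i = α := by
  have hcard : (Fintype.card ι : ℝ) ≠ 0 := by
    have : Nonempty ι := ⟨i⟩
    exact_mod_cast Fintype.card_ne_zero
  have hcard' : (Fintype.card ι : ℂ) ≠ 0 := by exact_mod_cast hcard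
  let K := IntermediateField.adjoin ℚ (Set.range f)
  have hint : ∀ i, IsIntegral ℚ (f i) := fun i =>
    IsIntegral.of_pow hN (by rw [hf i]; exact isIntegral_one)
  have : FiniteDimensional ℚ K := by
    refine IntermediateField.finiteDimensional_adjoin ?_
    rintro _ ⟨i, rfl⟩
    exact hint i
  have : NumberField K := { to_charZero := K.charZero, to_finiteDimensional := this }
  let f' : ι → K := fun i => ⟨f i, IntermediateField.subset_adjoin ℚ _ ⟨i, rfl⟩⟩
  have hf' : ∀ i, f' i ^ N = 1 := fun i => Subtype.ext (hf i)
  have hαK : α ∈ K := by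
    have : α = (Fintype.card ι : ℂ)⁻¹ * ∑ i, f i := by
      rw [← hsum]; field_simp
    rw [this]
    exact K.mul_mem (K.inv_mem (natCast_mem K _)) (sum_mem fun i _ => (f' i).2)
  let β : K := ⟨α, hαK⟩
  have hβsum : (Fintype.card ι : K) * β = ∑ i, f' i := by
    apply Subtype.ext
    push_cast
    exact hsum
  have hβ : IsIntegral ℤ β := by
    have : algebraMap K ℂ β = α := rfl
    rw [← this] at hα
    exact (isIntegral_algebraMap_iff (algebraMap K ℂ).injective).1 hα
  have hnorm : ∀ φ : K →+* ℂ, ‖φ β‖ ≤ 1 := by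
    intro φ
    have h1 : (Fintype.card ι : ℂ) * φ β = ∑ i, φ (f' i) := by
      rw [← map_sum, ← hβsum]; simp
    have h2 : ‖∑ i, φ (f' i)‖ ≤ Fintype.card ι := by
      refine (norm_sum_le _ _).trans ?_
      have : ∀ i, ‖φ (f' i)‖ = 1 := fun i =>
        Complex.norm_eq_one_of_pow_eq_one (by rw [← map_pow, hf', map_one]) hN.ne'
      simp [this]
    rw [← h1, norm_mul, Complex.norm_natCast] at h2
    have : (0 : ℝ) < Fintype.card ι := lt_of_le_of_ne (by positivity) hcard.symm
    nlinarith
  obtain ⟨k, hk, hβk⟩ := NumberField.Embeddings.pow_eq_one_of_norm_le_one K ℂ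
    (x := β) (fun h => hα0 (congrArg Subtype.val h)) hβ hnorm
  have hα1 : ‖α‖ = 1 := Complex.norm_eq_one_of_pow_eq_one (n := k) (congrArg Subtype.val hβk) hk.ne'
  have hf1 : ∀ j, ‖f j‖ = 1 := fun j => Complex.norm_eq_one_of_pow_eq_one (hf j) hN.ne'
  have hconj : α * (starRingEnd ℂ) α = 1 := by
    rw [Complex.mul_conj, Complex.normSq_eq_norm_sq, hα1]; simp
  have hle : ∀ j ∈ Finset.univ, (f j * (starRingEnd ℂ) α).re ≤ 1 := fun j _ => by
    refine (Complex.re_le_norm _).trans ?_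
    simp [hf1, hα1]
  have hre : ∑ j, (f j * (starRingEnd ℂ) α).re = ∑ j : ι, (1 : ℝ) := by
    rw [← Complex.re_sum, ← Finset.sum_mul, ← hsum, mul_assoc, hconj]
    simp
  have h1 := (Finset.sum_eq_sum_iff_of_le hle).1 hre i (Finset.mem_univ i)
  have h2 : f i * (starRingEnd ℂ) α = 1 := by
    have hn : ‖f i * (starRingEnd ℂ) α‖ = 1 := by simp [hf1, hα1]
    have h0 := Complex.sq_norm (f i * (starRingEnd ℂ) α)
    rw [hn, Complex.normSq_apply, h1] at h0
    exact Complex.ext (by simpa using h1) (by rw [Complex.one_im]; nlinarith)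
  calc f i = f i * (α * (starRingEnd ℂ) α) := by rw [hconj, mul_one]
    _ = (f i * (starRingEnd ℂ) α) * α := by ring
    _ = α := by rw [h2, one_mul]

namespace Matrix

variable {n : Type*} [Fintype n] [DecidableEq n]

theorem pow_eq_one_of_mem_roots_charpoly {A : Matrix n n ℂ} {N : ℕ} (hA : A ^ N = 1) {μ : ℂ}
    (hμ : μ ∈ A.charpoly.roots) : μ ^ N = 1 := by
  have h := mem_spectrum_of_isRoot_charpoly (Polynomial.isRoot_of_mem_roots hμ)
  have h2 := spectrum.pow_mem_pow A N h
  rw [hA] at h2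
  by_cases hn : Nonempty n
  · simpa [spectrum.one_eq] using h2
  · have := not_nonempty_iff.1 hn
    simp at h

theorem isIntegral_trace_of_pow_eq_one {A : Matrix n n ℂ} {N : ℕ} (hN : 0 < N) (hA : A ^ N = 1) :
    IsIntegral ℤ A.trace := by
  rw [trace_eq_sum_roots_charpoly]
  refine IsIntegral.multiset_sum fun μ hμ => IsIntegral.of_pow hN ?_
  rw [pow_eq_one_of_mem_roots_charpoly hA hμ]
  exact isIntegral_one

/-- The trace divided by the dimension is the average of the eigenvalues, so all eigenvalues are
`α`. A matrix of finite order is diagonalizable, since its minimal polynomial divides the separable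
`X ^ N - 1`. -/
theorem eq_scalar_of_isIntegral_trace_div {A : Matrix n n ℂ} {N : ℕ} (hN : 0 < N)
    (hA : A ^ N = 1) {α : ℂ} (hα : IsIntegral ℤ α) (hα0 : α ≠ 0)
    (htr : (Fintype.card n : ℂ) * α = A.trace) : A = scalar n α := by
  have hroots : ∀ μ ∈ A.charpoly.roots, μ = α := by
    intro μ hμ
    have hcard : Fintype.card A.charpoly.roots = Fintype.card n := by
      rw [Multiset.card_coe, ← (IsAlgClosed.splits A.charpoly).natDegree_eq_card_roots,
        charpoly_natDegree_eq_dim]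
    obtain ⟨i, rfl⟩ : ∃ i : A.charpoly.roots, (i : ℂ) = μ := by
      have := Multiset.map_univ_coe A.charpoly.roots
      rw [← this, Multiset.mem_map] at hμ
      obtain ⟨i, -, hi⟩ := hμ
      exact ⟨i, hi⟩
    refine eq_average_of_isIntegral_of_ne_zero hN (fun i : A.charpoly.roots => (i : ℂ))
      (fun i => pow_eq_one_of_mem_roots_charpoly hA (Multiset.coe_mem)) hα hα0 ?_ i
    rw [hcard, htr, trace_eq_sum_roots_charpoly]
    conv_lhs => rw [← Multiset.map_univ_coe A.charpoly.roots]
    rfl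
  have hsep : (minpoly ℂ A).Separable := by
    refine Polynomial.Separable.of_dvd (g := minpoly ℂ A)
      (Polynomial.separable_X_pow_sub_C (n := N) (1 : ℂ) (by exact_mod_cast hN.ne') one_ne_zero) ?_
    refine minpoly.dvd _ _ ?_
    simp [hA]
  have hdvd : minpoly ℂ A ∣ Polynomial.X - Polynomial.C α := by
    refine (IsAlgClosed.splits _).dvd_of_roots_le_roots (minpoly.ne_zero_of_finite ℂ A) ?_
    rw [Polynomial.roots_X_sub_C]
    refine (Multiset.le_iff_subset (Polynomial.nodup_roots hsep)).2 fun μ hμ => ?_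
    rw [Multiset.mem_singleton]
    exact hroots μ (Multiset.mem_of_le
      (Polynomial.roots.le_of_dvd A.charpoly_monic.ne_zero (minpoly_dvd_charpoly A)) hμ)
  have h0 := Polynomial.aeval_eq_zero_of_dvd_aeval_eq_zero hdvd (minpoly.aeval ℂ A)
  rw [map_sub, Polynomial.aeval_X, Polynomial.aeval_C, sub_eq_zero] at h0
  rw [h0]
  ext i j
  simp [algebraMap_matrix_apply, scalar_apply, diagonal_apply]

theorem trace_mulLeft (A : Matrix n n ℂ) :
    LinearMap.trace ℂ _ (LinearMap.mulLeft ℂ A) = Fintype.card n * A.trace := by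
  rw [LinearMap.trace_eq_matrix_trace ℂ (stdBasis ℂ n n)]
  have h : ∀ p : n × n, LinearMap.toMatrix (stdBasis ℂ n n) (stdBasis ℂ n n)
      (LinearMap.mulLeft ℂ A) p p = A p.1 p.1 := by
    rintro ⟨i, j⟩
    rw [LinearMap.toMatrix_apply, stdBasis_eq_single]
    change (A * (single i j 1 : Matrix n n ℂ)) i j = _
    simp
  rw [trace, Fintype.sum_prod_type]
  simp [diag, h, trace, Finset.mul_sum]

end Matrix

theorem LinearMap.trace_pi_map {ι : Type*} [Fintype ι] {V : ι → Type*}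
    [∀ i, AddCommGroup (V i)] [∀ i, Module ℂ (V i)] [∀ i, FiniteDimensional ℂ (V i)]
    (f : ∀ i, V i →ₗ[ℂ] V i) :
    LinearMap.trace ℂ (∀ i, V i) (LinearMap.pi fun i => f i ∘ₗ LinearMap.proj i) =
      ∑ i, LinearMap.trace ℂ (V i) (f i) := by
  classical
  rw [LinearMap.trace_eq_matrix_trace ℂ (Pi.basis fun i => Module.finBasis ℂ (V i))]
  simp only [Matrix.trace, Matrix.diag, LinearMap.toMatrix_apply, Fintype.sum_sigma]
  refine Finset.sum_congr rfl fun i _ => ?_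
  rw [LinearMap.trace_eq_matrix_trace ℂ (Module.finBasis ℂ (V i))]
  simp [Matrix.trace, LinearMap.toMatrix_apply]

theorem MonoidAlgebra.trace_mulLeft_of_ne_one {G : Type*} [Group G] [Finite G] {g : G}
    (hg : g ≠ 1) : LinearMap.trace ℂ _ (LinearMap.mulLeft ℂ (MonoidAlgebra.of ℂ G g)) = 0 := by
  classical
  have := Fintype.ofFinite G
  rw [LinearMap.trace_eq_matrix_trace ℂ (MonoidAlgebra.basis G ℂ)]
  simp only [Matrix.trace, Matrix.diag, LinearMap.toMatrix_apply]
  refine Finset.sum_eq_zero fun x _ => ?_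
  simp [MonoidAlgebra.basis, MonoidAlgebra.coeffLinearEquiv, hg]

/-! ### Characters and conjugacy classes of prime power size. -/

section Character

variable {G : Type*} [Group G] [Finite G] {d : ℕ}
theorem Matrix.isIntegral_sum_monoidHom (ρ : G →* Matrix (Fin d) (Fin d) ℂ) (C : Finset G) :
    IsIntegral ℤ (∑ x ∈ C, ρ x) := by
  have h : ∑ x ∈ C, ρ x =
      MonoidAlgebra.lift ℤ _ G ρ (∑ x ∈ C, MonoidAlgebra.of ℤ G x) := by
    simp
  rw [h]
  exact (IsIntegral.of_finite ℤ _).map _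

theorem Matrix.isIntegral_of_scalar [NeZero d] {c : ℂ} (h : IsIntegral ℤ (Matrix.scalar (Fin d) c)) :
    IsIntegral ℤ c := by
  have h1 : Matrix.scalar (Fin d) c = algebraMap ℂ (Matrix (Fin d) (Fin d) ℂ) c := rfl
  rw [h1] at h
  exact (isIntegral_algebraMap_iff (algebraMap ℂ (Matrix (Fin d) (Fin d) ℂ)).injective).1 h

/-- If the size of the conjugacy class of `g` is coprime to the degree of an irreducible
representation, then its character vanishes at `g` or `g` acts as a scalar. -/
theorem trace_eq_zero_or_eq_scalar_of_coprime [NeZero d]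
    (ρ : G →* Matrix (Fin d) (Fin d) ℂ)
    (hρ : Function.Surjective (MonoidAlgebra.lift ℂ _ G ρ)) (g : G)
    (hcop : Nat.Coprime (Nat.card (conjugatesOf g)) d) :
    (ρ g).trace = 0 ∨ ∃ c, ρ g = Matrix.scalar (Fin d) c := by
  classical
  have := Fintype.ofFinite G
  have hd : (d : ℂ) ≠ 0 := by exact_mod_cast NeZero.ne d
  let C : Finset G := (conjugatesOf g).toFinset
  have hC : ∀ x, x ∈ C ↔ IsConj g x := fun x => by simp only [C, Set.mem_toFinset]; exact Iff.rfl
  have hCcard : C.card = Nat.card (conjugatesOf g) := by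
    rw [Nat.card_eq_card_toFinset]
  have htr : ∀ x ∈ C, (ρ x).trace = (ρ g).trace := by
    intro x hx
    obtain ⟨y, rfl⟩ := isConj_iff.1 ((hC x).1 hx)
    rw [map_mul, Matrix.trace_mul_comm, ← map_mul]
    simp
  -- The class sum is central in the image of the group algebra, which is the full matrix algebra,
  -- so it is a scalar `ω`. It is integral because it comes from `ℤ[G]`.
  have hcomm : ∀ y : G, ρ y * ∑ x ∈ C, ρ x = (∑ x ∈ C, ρ x) * ρ y := by
    intro y
    rw [Finset.mul_sum, Finset.sum_mul]
    refine Finset.sum_nbij' (fun x => y * x * y⁻¹) (fun x => y⁻¹ * x * y) ?_ ?_ ?_ ?_ ?_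
    · intro x hx
      exact (hC _).2 (((hC x).1 hx).trans (isConj_iff.2 ⟨y, rfl⟩))
    · intro x hx
      exact (hC _).2 (((hC x).1 hx).trans (isConj_iff.2 ⟨y⁻¹, by group⟩))
    · intro x _; group
    · intro x _; group
    · intro x _
      rw [← map_mul, ← map_mul]
      congr 1
      group
  have hcenter : ∀ A : Matrix (Fin d) (Fin d) ℂ, Commute A (∑ x ∈ C, ρ x) := by
    intro A
    obtain ⟨a, rfl⟩ := hρ A
    induction a using MonoidAlgebra.induction_on with
    | of y => rw [MonoidAlgebra.lift_of]; exact hcomm y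
    | add a b ha hb => rw [map_add]; exact ha.add_left hb
    | smul r a ha => rw [map_smul]; exact ha.smul_left r
  obtain ⟨ω, hω⟩ := Matrix.mem_range_scalar_iff_commute_single'.2 fun i j => hcenter _
  have hωint : IsIntegral ℤ ω := Matrix.isIntegral_of_scalar (d := d) <| by
    rw [hω]; exact Matrix.isIntegral_sum_monoidHom ρ C
  have hωtr : (d : ℂ) * ω = C.card * (ρ g).trace := by
    have := congrArg Matrix.trace hω
    rw [Matrix.trace_sum, Finset.sum_congr rfl htr] at this
    simpa [Matrix.scalar_apply, Matrix.trace_diagonal] using this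
  have hpow : ρ g ^ Nat.card G = 1 := by rw [← map_pow, pow_card_eq_one', map_one]
  have hχint := Matrix.isIntegral_trace_of_pow_eq_one Nat.card_pos hpow
  -- Bézout: if `u|C| + vd = 1`, then `α = uω + v tr ρ(g)` is integral and equals `tr ρ(g) / d`.
  obtain ⟨α, hα, hαtr⟩ : ∃ α : ℂ, IsIntegral ℤ α ∧ (d : ℂ) * α = (ρ g).trace := by
    have hb := Nat.gcd_eq_gcd_ab C.card d
    rw [hCcard, hcop.gcd_eq_one, ← hCcard] at hb
    have hb' : (1 : ℂ) = C.card * (C.card.gcdA d : ℤ) + d * (C.card.gcdB d : ℤ) := by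
      exact_mod_cast hb
    refine ⟨(C.card.gcdA d : ℤ) * ω + (C.card.gcdB d : ℤ) * (ρ g).trace,
      ((isIntegral_algebraMap (R := ℤ)).mul hωint).add
        ((isIntegral_algebraMap (R := ℤ)).mul hχint), ?_⟩
    linear_combination (C.card.gcdA d : ℂ) * hωtr - (ρ g).trace * hb'
  by_cases hα0 : α = 0
  · left; rw [← hαtr, hα0, mul_zero]
  · right
    exact ⟨α, Matrix.eq_scalar_of_isIntegral_trace_div Nat.card_pos hpow hα hα0
      (by simpa using hαtr)⟩

end Character

theorem Nat.Prime.not_isIntegral_neg_one_div {p : ℕ} (hp : p.Prime) {α : ℂ} (hα : IsIntegral ℤ α)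
    (h : 1 + p * α = 0) : False := by
  have hp0 : (p : ℂ) ≠ 0 := by exact_mod_cast hp.ne_zero
  have h1 : α = algebraMap ℚ ℂ (-1 / p) := by
    have : p * α = -1 := by linear_combination h
    simp only [eq_ratCast]
    push_cast
    field_simp
    linear_combination this
  rw [h1, isIntegral_algebraMap_iff (algebraMap ℚ ℂ).injective] at hα
  obtain ⟨k, hk⟩ := IsIntegrallyClosed.isIntegral_iff.1 hα
  have hp0' : (p : ℚ) ≠ 0 := by exact_mod_cast hp.ne_zero
  have h2 : (p : ℤ) * k = -1 := by
    have : (p : ℚ) * k = -1 := by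
      simp only [eq_intCast] at hk
      rw [hk]; field_simp
    exact_mod_cast this
  have h3 : (p : ℤ) ∣ 1 := ⟨-k, by linear_combination h2⟩
  exact hp.one_lt.ne' (by exact_mod_cast Int.eq_one_of_dvd_one (by positivity) h3)

/-- **Burnside**: a non-abelian finite simple group has no conjugacy class of prime power size,
except for the trivial one. -/
theorem IsSimpleGroup.false_of_card_conjugatesOf {G : Type*} [Group G] [Finite G]
    [IsSimpleGroup G] {p k : ℕ} (hp : p.Prime) {g : G} (hg : g ∉ Subgroup.center G)
    (hk : Nat.card (conjugatesOf g) = p ^ k) : False := by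
  classical
  have := Fintype.ofFinite G
  have hg1 : g ≠ 1 := fun h => hg (h ▸ one_mem _)
  obtain ⟨r, d, hd, ⟨e⟩⟩ :=
    IsSemisimpleRing.exists_algEquiv_pi_matrix_of_isAlgClosed ℂ (MonoidAlgebra ℂ G)
  let π : ∀ i, MonoidAlgebra ℂ G →ₐ[ℂ] Matrix (Fin (d i)) (Fin (d i)) ℂ := fun i =>
    (Pi.evalAlgHom ℂ _ i).comp e.toAlgHom
  let ρ : ∀ i, G →* Matrix (Fin (d i)) (Fin (d i)) ℂ := fun i =>
    (MonoidAlgebra.lift ℂ _ G).symm (π i)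
  have hπ : ∀ i, MonoidAlgebra.lift ℂ _ G (ρ i) = π i := fun i =>
    (MonoidAlgebra.lift ℂ _ G).apply_symm_apply _
  have hsurj : ∀ i, Function.Surjective (π i) := fun i =>
    (Function.surjective_eval i).comp e.surjective
  have hρe : ∀ i x, ρ i x = e (MonoidAlgebra.of ℂ G x) i := fun i x => rfl
  -- Column orthogonality of `g` with 1, obtained by computing the trace of `g` on the regular
  -- representation through the Wedderburn decomposition.
  have htrace : ∑ i, (d i : ℂ) * (ρ i g).trace = 0 := by
    rw [← MonoidAlgebra.trace_mulLeft_of_ne_one hg1, ← LinearMap.trace_conj' _ e.toLinearEquiv]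
    have : e.toLinearEquiv.conj (LinearMap.mulLeft ℂ (MonoidAlgebra.of ℂ G g)) =
        LinearMap.pi fun i => LinearMap.mulLeft ℂ (ρ i g) ∘ₗ LinearMap.proj i := by
      refine LinearMap.ext fun x => funext fun i => ?_
      simp [LinearEquiv.conj_apply, hρe]
    rw [this, LinearMap.trace_pi_map]
    simp [Matrix.trace_mulLeft]
  -- the trivial representation occurs
  obtain ⟨i₀, hi₀⟩ : ∃ i, ∀ x, ρ i x = 1 := by
    let z : MonoidAlgebra ℂ G := ∑ x, MonoidAlgebra.of ℂ G x
    have hzl : ∀ x, MonoidAlgebra.of ℂ G x * z = z := fun x => by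
      simp only [z, Finset.mul_sum, ← map_mul]
      exact Fintype.sum_equiv (Equiv.mulLeft x) _ _ fun y => rfl
    have hzr : ∀ x, z * MonoidAlgebra.of ℂ G x = z := fun x => by
      simp only [z, Finset.sum_mul, ← map_mul]
      exact Fintype.sum_equiv (Equiv.mulRight x) _ _ fun y => rfl
    have hz : z ≠ 0 := by
      intro h
      have h1 := congrArg (MonoidAlgebra.lift ℂ ℂ G 1) h
      simp [z] at h1
    obtain ⟨i, hi⟩ : ∃ i, π i z ≠ 0 := by
      by_contra! h
      exact hz (e.injective (by rw [map_zero]; funext i; exact h i))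
    refine ⟨i, fun x => ?_⟩
    -- The component of `z` in block `i` is central, hence a nonzero scalar. Multiplication by `ρ i
    -- x` fixes it, so `ρ i x = 1`.
    have hcomm : ∀ A : Matrix (Fin (d i)) (Fin (d i)) ℂ, Commute A (π i z) := by
      intro A
      obtain ⟨a, rfl⟩ := hsurj i A
      refine Commute.map (f := π i) ?_
      induction a using MonoidAlgebra.induction_on with
      | of y => rw [Commute, SemiconjBy, hzl, hzr]
      | add a b ha hb => exact ha.add_left hb
      | smul r a ha => exact ha.smul_left r
    obtain ⟨c, hc⟩ := Matrix.mem_range_scalar_iff_commute_single'.2 fun j k => hcomm _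
    have hc0 : c ≠ 0 := by rintro rfl; exact hi (by rw [← hc, map_zero])
    have h1 : ρ i x * Matrix.scalar _ c = Matrix.scalar _ c := by
      rw [hc]; change π i _ * π i z = _; rw [← map_mul, hzl]
    have h2 : Matrix.scalar (Fin (d i)) c * Matrix.scalar _ c⁻¹ = 1 := by
      rw [← map_mul, mul_inv_cancel₀ hc0, map_one]
    calc ρ i x = ρ i x * (Matrix.scalar (Fin (d i)) c * Matrix.scalar _ c⁻¹) := by
          rw [h2, mul_one]
      _ = 1 := by rw [← mul_assoc, h1, h2]
  -- a representation in which every group element acts trivially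
  have htriv : ∀ i, (∀ x, ρ i x = 1) → ∀ a : MonoidAlgebra ℂ G,
      π i a = Matrix.scalar _ (MonoidAlgebra.lift ℂ ℂ G 1 a) := by
    intro i hi a
    induction a using MonoidAlgebra.induction_on with
    | of y =>
      have : π i (MonoidAlgebra.of ℂ G y) = 1 := hi y
      rw [this]; simp
    | add a b ha hb => simp only [map_add, ha, hb]
    | smul r a ha =>
      rw [map_smul, map_smul, ha]
      ext j k
      simp [Matrix.scalar_apply, Matrix.diagonal_apply]
  have hdim : ∀ i, (∀ x, ρ i x = 1) → d i = 1 := by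
    intro i hi
    by_contra hne
    have h2 : 1 < d i := by have := (hd i).out; omega
    obtain ⟨a, ha⟩ := hsurj i (Matrix.single ⟨0, by omega⟩ ⟨1, h2⟩ 1)
    rw [htriv i hi] at ha
    have := congrFun (congrFun ha ⟨0, by omega⟩) ⟨1, h2⟩
    simp [Matrix.scalar_apply] at this
  have huniq : ∀ i, (∀ x, ρ i x = 1) → i = i₀ := by
    intro i hi
    by_contra hne
    -- On a trivial block the projection is the augmentation, so two such blocks could not be
    -- separated by an element of the algebra.
    obtain ⟨a, ha⟩ := e.surjective (Pi.single i 1)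
    have h1 : π i a = 1 := by change e a i = 1; rw [ha]; simp
    have h2 : π i₀ a = 0 := by
      change e a i₀ = 0; rw [ha]; exact Pi.single_eq_of_ne (Ne.symm hne) _
    rw [htriv i hi] at h1
    rw [htriv i₀ hi₀] at h2
    have := hd i
    have := hd i₀
    have h3 := congrFun (congrFun h1 0) 0
    have h4 := congrFun (congrFun h2 0) 0
    simp only [Matrix.scalar_apply, Matrix.diagonal_apply_eq, Matrix.one_apply_eq,
      Matrix.zero_apply] at h3 h4
    rw [h3] at h4
    exact one_ne_zero h4
  have hscalar : ∀ i, i ≠ i₀ → ¬ ∃ c, ρ i g = Matrix.scalar _ c := by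
    rintro i hi ⟨c, hc⟩
    -- By simplicity `ρ i` is faithful or trivial. If it is faithful, a scalar image makes `g`
    -- central.
    have hker : (ρ i).ker = ⊥ ∨ (ρ i).ker = ⊤ := (MonoidHom.normal_ker _).eq_bot_or_eq_top
    rcases hker with hk | hk
    · refine hg (Subgroup.mem_center_iff.2 fun x => ?_)
      apply (MonoidHom.ker_eq_bot_iff _).1 hk
      rw [map_mul, map_mul, hc]
      exact (Matrix.scalar_commute c (fun r => mul_comm _ _) _).symm
    · exact hi (huniq i fun x => by
        have : x ∈ (ρ i).ker := hk ▸ Subgroup.mem_top x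
        exact this)
  have hterm : ∀ i, i ≠ i₀ → ∃ α : ℂ, IsIntegral ℤ α ∧ (d i : ℂ) * (ρ i g).trace = p * α := by
    intro i hi
    have := hd i
    by_cases hpd : p ∣ d i
    · obtain ⟨c, hc⟩ := hpd
      refine ⟨c * (ρ i g).trace, (isIntegral_algebraMap (R := ℤ) (x := (c : ℤ))).mul
        (Matrix.isIntegral_trace_of_pow_eq_one (N := Nat.card G) Nat.card_pos
          (by rw [← map_pow, pow_card_eq_one', map_one])), ?_⟩
      have hc' : (d i : ℂ) = p * c := by exact_mod_cast hc
      rw [hc', mul_assoc]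
    · refine ⟨0, isIntegral_zero, ?_⟩
      have hcop : Nat.Coprime (Nat.card (conjugatesOf g)) (d i) := by
        rw [hk]; exact Nat.Coprime.pow_left _ ((Nat.Prime.coprime_iff_not_dvd hp).2 hpd)
      rcases trace_eq_zero_or_eq_scalar_of_coprime (ρ i) (by rw [hπ]; exact hsurj i) g hcop
        with h | h
      · rw [h]; simp
      · exact absurd h (hscalar i hi)
  choose! α hα hαe using hterm
  -- The trivial block contributes 1 to the orthogonality sum and every other block a multiple of
  -- `p`, so `-1/p` would be an algebraic integer.
  refine hp.not_isIntegral_neg_one_div (α := ∑ i ∈ Finset.univ.erase i₀, α i)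
    (IsIntegral.sum _ fun i hi => hα i (Finset.ne_of_mem_erase hi)) ?_
  rw [← htrace, ← Finset.add_sum_erase _ _ (Finset.mem_univ i₀), Finset.mul_sum,
    Finset.sum_congr rfl fun i hi => (hαe i (Finset.ne_of_mem_erase hi)), hi₀ g]
  simp [hdim i₀ hi₀]

/-! ### Burnside's theorem on groups whose order involves two primes. -/

theorem card_conjugatesOf_dvd_index {G : Type*} [Group G] [Finite G] {g : G} {Q : Subgroup G}
    (hQ : ∀ x ∈ Q, x * g = g * x) : Nat.card (conjugatesOf g) ∣ Q.index := by
  have h1 : Nat.card (conjugatesOf g) = (MulAction.stabilizer (ConjAct G) g).index := by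
    rw [MulAction.index_stabilizer, ConjAct.orbit_eq_carrier_conjClasses]
    congr 1
  have h2 : Q.map (ConjAct.toConjAct (G := G)).toMonoidHom ≤
      MulAction.stabilizer (ConjAct G) g := by
    rintro _ ⟨x, hx, rfl⟩
    rw [MulAction.mem_stabilizer_iff]
    change ConjAct.toConjAct x • g = g
    rw [ConjAct.toConjAct_smul, hQ x hx, mul_inv_cancel_right]
  have h3 := Subgroup.index_dvd_of_le h2
  rw [h1]
  rwa [Subgroup.index_map_of_bijective (ConjAct.toConjAct (G := G)).bijective] at h3

/-- **Burnside's `p ^ a * q ^ b` theorem**. -/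
theorem Group.isSolvable_of_card_eq_prime_pow_mul_prime_pow {p q : ℕ} (hp : p.Prime)
    (hq : q.Prime) (G : Type u) [Group G] [Finite G] {a b : ℕ}
    (hG : Nat.card G = p ^ a * q ^ b) : Group.IsSolvable G := by
  induction hn : Nat.card G using Nat.strong_induction_on generalizing G a b with
  | _ n ih =>
  subst hn
  have hform : ∀ m, m ∣ Nat.card G → ∃ c d, m = p ^ c * q ^ d := by
    intro m hm
    rw [hG] at hm
    obtain ⟨x, y, hx, hy, rfl⟩ := exists_dvd_and_dvd_of_dvd_mul hm
    obtain ⟨i, -, rfl⟩ := (Nat.dvd_prime_pow hp).1 hx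
    obtain ⟨j, -, rfl⟩ := (Nat.dvd_prime_pow hq).1 hy
    exact ⟨i, j, rfl⟩
  by_cases hsimple : ∃ N : Subgroup G, N.Normal ∧ N ≠ ⊥ ∧ N ≠ ⊤
  · obtain ⟨N, hN, hbot, htop⟩ := hsimple
    obtain ⟨c, d, hcd⟩ := hform _ (Subgroup.card_subgroup_dvd_card N)
    obtain ⟨c', d', hcd'⟩ := hform _ (Subgroup.card_quotient_dvd_card N)
    have hmul := Subgroup.card_eq_card_quotient_mul_card_subgroup N
    have h1 : 1 < Nat.card N := (Subgroup.one_lt_card_iff_ne_bot N).2 hbot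
    have h2 : Nat.card N < Nat.card G := lt_of_le_of_ne (Subgroup.card_le_card_group N)
      fun h => htop (Subgroup.card_eq_iff_eq_top N |>.1 h)
    have h3 : Nat.card (G ⧸ N) < Nat.card G := by
      have : 0 < Nat.card (G ⧸ N) := Nat.card_pos
      nlinarith
    have := ih _ h2 N hcd rfl
    have := ih _ h3 (G ⧸ N) hcd' rfl
    exact (Group.isSolvable_iff_subgroup_quotient N).2 ⟨inferInstance, inferInstance⟩
  push Not at hsimple
  rcases subsingleton_or_nontrivial G with _ | _
  · infer_instance
  have : IsSimpleGroup G := ⟨fun N hN => or_iff_not_imp_left.2 (hsimple N hN)⟩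
  have : Fact p.Prime := ⟨hp⟩
  have : Fact q.Prime := ⟨hq⟩
  rcases (inferInstance : (Subgroup.center G).Normal).eq_bot_or_eq_top with hZ | hZ
  swap
  · exact IsSimpleGroup.comm_iff_isSolvable.1 fun x y =>
      (Subgroup.mem_center_iff.1 (hZ ▸ Subgroup.mem_top y : y ∈ Subgroup.center G) x)
  exfalso
  obtain ⟨Q⟩ : Nonempty (Sylow q G) := inferInstance
  -- A class whose size divides the index of `Q` has `p`-power size. This will apply to a central
  -- element of `Q`; if `Q` is trivial, `G` is a `p`-group and has nontrivial center anyway.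
  have hindex : ∀ (g : G), Nat.card (conjugatesOf g) ∣ (Q : Subgroup G).index → g = 1 := by
    intro g hg
    by_contra hg1
    have hdvd : Nat.card (conjugatesOf g) ∣ p ^ a := by
      have h1 : Nat.card (conjugatesOf g) ∣ p ^ a * q ^ b :=
        hG ▸ hg.trans (Subgroup.index_dvd_card _)
      refine Nat.Coprime.dvd_of_dvd_mul_right (Nat.Coprime.pow_right b ?_) h1
      exact ((Nat.Prime.coprime_iff_not_dvd hq).2 fun h =>
        Q.not_dvd_index (h.trans hg)).symm
    obtain ⟨k, -, hk⟩ := (Nat.dvd_prime_pow hp).1 hdvd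
    refine IsSimpleGroup.false_of_card_conjugatesOf hp (fun h => hg1 ?_) hk
    rwa [hZ, Subgroup.mem_bot] at h
  rcases subsingleton_or_nontrivial Q with hQ | hQ
  · have h1 : (Q : Subgroup G).index = Nat.card G := by
      rw [Subgroup.eq_bot_of_subsingleton (Q : Subgroup G), Subgroup.index_bot]
    have h2 : ¬ q ∣ Nat.card G := h1 ▸ Q.not_dvd_index
    have h3 : Nat.card G ∣ p ^ a := by
      refine Nat.Coprime.dvd_of_dvd_mul_right (Nat.Coprime.pow_right b ?_) hG.dvd
      exact ((Nat.Prime.coprime_iff_not_dvd hq).2 h2).symm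
    obtain ⟨k, -, hk⟩ := (Nat.dvd_prime_pow hp).1 h3
    have := (IsPGroup.of_card hk).center_nontrivial
    exact (Subgroup.nontrivial_iff_ne_bot _).1 this hZ
  · have := Q.isPGroup'.center_nontrivial
    obtain ⟨⟨z, hz⟩, hz1⟩ := exists_ne (1 : Subgroup.center Q)
    refine hz1 (Subtype.ext (Subtype.ext (hindex z (card_conjugatesOf_dvd_index fun x hx => ?_))))
    exact congrArg Subtype.val (Subgroup.mem_center_iff.1 hz ⟨x, hx⟩)

/-! ### Cyclic subgroups away from two primes. -/

theorem Nat.eq_pow_mul_pow_or_exists_prime (q r : ℕ) {n : ℕ} (hn : n ≠ 0) :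
    (∃ a b : ℕ, n = q ^ a * r ^ b) ∨ ∃ p : ℕ, p.Prime ∧ p ≠ q ∧ p ≠ r ∧ p ∣ n := by
  refine or_iff_not_imp_right.2 fun h => ?_
  push Not at h
  induction n using Nat.recOnMul with
  | zero => exact absurd rfl hn
  | one => exact ⟨0, 0, by simp⟩
  | prime p hp =>
    by_cases h1 : p = q
    · exact ⟨1, 0, by simp [h1]⟩
    by_cases h2 : p = r
    · exact ⟨0, 1, by simp [h2]⟩
    exact absurd dvd_rfl (h p hp h1 h2)
  | mul m k hm hk =>
    obtain ⟨a, b, h1⟩ := hm (left_ne_zero_of_mul hn)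
      fun p h1 h2 h3 h4 => h p h1 h2 h3 (h4.mul_right _)
    obtain ⟨c, d, h2⟩ := hk (right_ne_zero_of_mul hn)
      fun p h1 h2 h3 h4 => h p h1 h2 h3 (h4.mul_left _)
    exact ⟨a + c, b + d, by rw [h1, h2]; ring⟩

/-- All `p`-subgroups of `G` are cyclic, for each prime `p` other than `q` and `r`. -/
def CyclicPSubgroupsAway (q r : ℕ) (G : Type*) [Group G] : Prop :=
  ∀ p : ℕ, p.Prime → p ≠ q → p ≠ r → ∀ P : Subgroup G, IsPGroup p P → IsCyclic P

namespace CyclicPSubgroupsAway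

variable {q r : ℕ} {G : Type*} [Group G]

theorem of_sylow (h : ∀ p : ℕ, p.Prime → p ≠ q → p ≠ r → ∀ P : Sylow p G, IsCyclic P) :
    CyclicPSubgroupsAway q r G := by
  intro p hp hpq hpr P hP
  obtain ⟨Q, hQ⟩ := hP.exists_le_sylow
  have := h p hp hpq hpr Q
  exact Subgroup.isCyclic_of_le hQ

theorem subgroup (h : CyclicPSubgroupsAway q r G) (H : Subgroup G) :
    CyclicPSubgroupsAway q r H := by
  intro p hp hpq hpr P hP
  have := h p hp hpq hpr (P.map H.subtype) (hP.map _)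
  exact isCyclic_of_surjective _
    (P.equivMapOfInjective H.subtype H.subtype_injective).symm.surjective

theorem quotient [Finite G] (h : CyclicPSubgroupsAway q r G) (N : Subgroup G) [N.Normal] :
    CyclicPSubgroupsAway q r (G ⧸ N) := by
  refine of_sylow fun p hp hpq hpr P => ?_
  have := Fact.mk hp
  obtain ⟨Q, rfl⟩ := Sylow.mapSurjective_surjective (QuotientGroup.mk'_surjective N) p P
  have := h p hp hpq hpr Q Q.isPGroup'
  exact isCyclic_of_surjective _ ((QuotientGroup.mk' N).subgroupMap_surjective (Q : Subgroup G))

/-- Two commuting subgroups of order divisible by `p` intersect nontrivially. -/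
theorem not_disjoint [Finite G] (h : CyclicPSubgroupsAway q r G) {p : ℕ} (hp : p.Prime)
    (hpq : p ≠ q) (hpr : p ≠ r) {X Y : Subgroup G}
    (hXY : ∀ x ∈ X, ∀ y ∈ Y, x * y = y * x) (hX : p ∣ Nat.card X) (hY : p ∣ Nat.card Y) :
    ¬ Disjoint X Y := by
  classical
  intro hdisj
  have := Fact.mk hp
  have := Fintype.ofFinite G
  obtain ⟨⟨x, hx⟩, hxo⟩ := exists_prime_orderOf_dvd_card' p hX
  obtain ⟨⟨y, hy⟩, hyo⟩ := exists_prime_orderOf_dvd_card' p hY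
  rw [Subgroup.orderOf_mk] at hxo hyo
  have hpg : ∀ z : G, orderOf z = p → IsPGroup p (Subgroup.zpowers z) := fun z hz =>
    IsPGroup.of_card (n := 1) (by rw [Nat.card_zpowers, hz, pow_one])
  let H := Subgroup.zpowers x ⊔ Subgroup.zpowers y
  have hH : IsPGroup p H := by
    refine IsPGroup.to_sup_of_normal_right' (hpg x hxo) (hpg y hyo) ?_
    refine le_trans ?_ (Subgroup.centralizer_le_normalizer _)
    rw [Subgroup.zpowers_le, Subgroup.mem_centralizer_iff]
    intro z hz
    exact (hXY x hx z (Subgroup.zpowers_le.2 hy hz)).symm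
  have hcyc : IsCyclic H := h p hp hpq hpr H hH
  have hle := IsCyclic.card_pow_eq_one_le (α := H) hp.pos
  have hmem : ∀ z : G, orderOf z = p → ∀ hz : z ∈ H, ∀ k : ℕ, (⟨z, hz⟩ : H) ^ k ∈
      Finset.univ.filter fun w : H => w ^ p = 1 := by
    intro z hz hzH k
    rw [Finset.mem_filter]
    refine ⟨Finset.mem_univ _, Subtype.ext ?_⟩
    push_cast
    rw [← pow_mul, mul_comm, pow_mul, ← hz, pow_orderOf_eq_one, one_pow]
  have hxH : x ∈ H := Subgroup.mem_sup_left (Subgroup.mem_zpowers x)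
  have hyH : y ∈ H := Subgroup.mem_sup_right (Subgroup.mem_zpowers y)
  -- A cyclic group has at most `p` solutions of `w ^ p = 1`, and the powers of `x` already supply
  -- `p` of them. So `y` is a power of `x`.
  have himg : ((Finset.range p).image fun k => (⟨x, hxH⟩ : H) ^ k) =
      Finset.univ.filter fun w : H => w ^ p = 1 := by
    refine Finset.eq_of_subset_of_card_le ?_ (hle.trans_eq ?_)
    · intro w hw
      obtain ⟨k, -, rfl⟩ := Finset.mem_image.1 hw
      exact hmem x hxo hxH k
    · rw [Finset.card_image_of_injOn, Finset.card_range]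
      intro i hi j hj hij
      have hij' : x ^ i = x ^ j := congrArg Subtype.val hij
      rw [Finset.coe_range, Set.mem_Iio] at hi hj
      exact pow_injOn_Iio_orderOf (by simpa [hxo] using hi) (by simpa [hxo] using hj) hij'
  have hy1 := hmem y hyo hyH 1
  rw [pow_one, ← himg] at hy1
  obtain ⟨k, -, hk⟩ := Finset.mem_image.1 hy1
  have hk' : x ^ k = y := congrArg Subtype.val hk
  have : y = 1 := Subgroup.disjoint_def.1 hdisj (hk' ▸ X.pow_mem hx k) hy
  rw [this, orderOf_one] at hyo
  exact hp.one_lt.ne hyo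

end CyclicPSubgroupsAway

/-! ### Perfect groups, transfer and the core. -/

open scoped IsMulCommutative in
/-- In a finite perfect group with cyclic Sylow `p`-subgroups, there are no central elements of
order `p`. -/
theorem Group.IsPerfect.eq_one_of_mem_center_of_pow_eq_one {G : Type*} [Group G] [Finite G]
    [Group.IsPerfect G] {p : ℕ} [Fact p.Prime] (hP : ∀ P : Sylow p G, IsCyclic P) {z : G}
    (hz : z ∈ Subgroup.center G) (hzp : z ^ p = 1) : z = 1 := by
  have hpg : IsPGroup p (Subgroup.zpowers z) := by
    rintro ⟨_, k, rfl⟩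
    refine ⟨1, Subtype.ext ?_⟩
    change (z ^ k) ^ p ^ 1 = 1
    rw [pow_one, ← zpow_natCast, ← zpow_mul, mul_comm, zpow_mul, zpow_natCast, hzp, one_zpow]
  obtain ⟨P, hzP⟩ := hpg.exists_le_sylow
  rw [Subgroup.zpowers_le] at hzP
  have := hP P
  -- The transfer into the abelian group `P` kills the perfect group `G`, but sends a central `z` to
  -- its power with exponent the index of `P`, which is prime to `p`.
  let τ : G →* (P : Subgroup G) := MonoidHom.transfer (MonoidHom.id (P : Subgroup G))
  have hτ : τ z = 1 := by
    have h1 : z ∈ commutator G := Group.IsPerfect.mem_commutator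
    exact Abelianization.commutator_subset_ker τ h1
  have hτz : τ z = _ := MonoidHom.transfer_eq_pow (MonoidHom.id (P : Subgroup G)) z
    fun k g₀ _ => by
      rw [mul_assoc, ← Subgroup.mem_center_iff.1 (Subgroup.pow_mem _ hz k) g₀,
        inv_mul_cancel_left]
  rw [hτ] at hτz
  have h1 : z ^ (P : Subgroup G).index = 1 := (congrArg Subtype.val hτz).symm
  have h2 : orderOf z ∣ p := orderOf_dvd_of_pow_eq_one hzp
  have h3 : orderOf z ∣ (P : Subgroup G).index := orderOf_dvd_of_pow_eq_one h1
  have hcop : Nat.Coprime p (P : Subgroup G).index :=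
    ((Fact.out : p.Prime).coprime_iff_not_dvd).2 P.not_dvd_index
  exact orderOf_eq_one_iff.1 (Nat.eq_one_of_dvd_coprimes hcop h2 h3)

theorem Subgroup.sSup_characteristic {G : Type*} [Group G] (S : Set (Subgroup G))
    (hS : ∀ φ : G ≃* G, ∀ N ∈ S, N.map φ.toMonoidHom ∈ S) : (sSup S).Characteristic := by
  rw [Subgroup.characteristic_iff_map_le]
  intro φ
  rw [Subgroup.map_le_iff_le_comap]
  refine sSup_le fun N hN => ?_
  rw [← Subgroup.map_le_iff_le_comap]
  exact le_sSup (hS φ N hN)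

theorem Subgroup.card_map_mulEquiv {G H : Type*} [Group G] [Group H] (φ : G ≃* H)
    (N : Subgroup G) : Nat.card (N.map φ.toMonoidHom) = Nat.card N :=
  (Nat.card_congr (φ.subgroupMap N).toEquiv).symm

instance twoPrimeCore_characteristic (q r : ℕ) (G : Type*) [Group G] :
    (twoPrimeCore q r G).Characteristic := by
  refine Subgroup.sSup_characteristic _ fun φ N hN => ?_
  have := hN.1
  exact ⟨hN.1.map _ φ.surjective, by rw [Subgroup.card_map_mulEquiv]; exact hN.2⟩

/-- A characteristic subgroup of a normal subgroup is normal, so the core of `N` lies in that of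
`G`. -/
theorem twoPrimeCore_eq_bot_of_normal {q r : ℕ} (hq : q.Prime) (hr : r.Prime) {G : Type*}
    [Group G] [Finite G] (h : twoPrimeCore q r G = ⊥) (N : Subgroup G) [N.Normal] :
    twoPrimeCore q r N = ⊥ := by
  obtain ⟨a, b, hab⟩ := (twoPrimeCore_isGreatest hq hr N).1.2
  have h1 : (twoPrimeCore q r N).map N.subtype ≤ twoPrimeCore q r G := by
    refine le_sSup ⟨inferInstance, a, b, ?_⟩
    rw [Subgroup.card_map_of_injective N.subtype_injective, hab]
  rw [h, le_bot_iff] at h1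
  exact (Subgroup.map_eq_bot_iff_of_injective _ N.subtype_injective).1 h1

theorem twoPrimeCore_quotient {q r : ℕ} (hq : q.Prime) (hr : r.Prime) (G : Type*)
    [Group G] [Finite G] : twoPrimeCore q r (G ⧸ twoPrimeCore q r G) = ⊥ := by
  obtain ⟨a, b, hab⟩ := (twoPrimeCore_isGreatest hq hr G).1.2
  refine le_bot_iff.1 (sSup_le ?_)
  rintro N ⟨hN, c, d, hcd⟩
  have hle : N.comap (QuotientGroup.mk' (twoPrimeCore q r G)) ≤ twoPrimeCore q r G := by
    refine le_sSup ⟨inferInstance, a + c, b + d, ?_⟩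
    have h1 := Subgroup.index_comap_of_surjective N
      (QuotientGroup.mk'_surjective (twoPrimeCore q r G))
    have h2 := (N.comap (QuotientGroup.mk' (twoPrimeCore q r G))).card_mul_index
    rw [h1, Subgroup.card_eq_card_quotient_mul_card_subgroup (twoPrimeCore q r G),
      ← N.card_mul_index, hab, hcd] at h2
    have h3 : 0 < N.index := Nat.pos_of_ne_zero Subgroup.FiniteIndex.index_ne_zero
    refine Nat.eq_of_mul_eq_mul_right h3 (h2.trans ?_)
    ring
  have h2 := Subgroup.map_mono (f := QuotientGroup.mk' (twoPrimeCore q r G)) hle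
  rwa [Subgroup.map_comap_eq_self_of_surjective (QuotientGroup.mk'_surjective _),
    QuotientGroup.map_mk'_self] at h2

/-- `H ⊓ K` is central in `H ⊔ K` and contains the commutators of `H` with `K`. Modulo it, the join
is abelian. -/
theorem Subgroup.isNilpotent_sup_of_isMulCommutative {G : Type*} [Group G] {H K : Subgroup G}
    [H.Normal] [K.Normal] (hH : ∀ x ∈ H, ∀ y ∈ H, x * y = y * x)
    (hK : ∀ x ∈ K, ∀ y ∈ K, x * y = y * x) :
    Group.IsNilpotent (H ⊔ K : Subgroup G) := by
  let π := QuotientGroup.mk' (H ⊓ K)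
  let f : (H ⊔ K : Subgroup G) →* G ⧸ (H ⊓ K) := π.comp (H ⊔ K).subtype
  have hHH : H.map π ≤ Subgroup.centralizer (H.map π) := by
    rintro _ ⟨x, hx, rfl⟩
    rw [Subgroup.mem_centralizer_iff]
    rintro _ ⟨y, hy, rfl⟩
    rw [← map_mul, ← map_mul, hH y hy x hx]
  have hKK : K.map π ≤ Subgroup.centralizer (K.map π) := by
    rintro _ ⟨x, hx, rfl⟩
    rw [Subgroup.mem_centralizer_iff]
    rintro _ ⟨y, hy, rfl⟩
    rw [← map_mul, ← map_mul, hK y hy x hx]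
  have hHK : H.map π ≤ Subgroup.centralizer (K.map π) := by
    rintro _ ⟨x, hx, rfl⟩
    rw [Subgroup.mem_centralizer_iff]
    rintro _ ⟨y, hy, rfl⟩
    rw [← map_mul, ← map_mul]
    refine (QuotientGroup.eq).2 ⟨?_, ?_⟩
    · have : (y * x)⁻¹ * (x * y) = x⁻¹ * (y⁻¹ * x * y) := by group
      rw [this]
      refine H.mul_mem (H.inv_mem hx) ?_
      simpa using (inferInstance : H.Normal).conj_mem x hx y⁻¹
    · have : (y * x)⁻¹ * (x * y) = (x⁻¹ * y⁻¹ * x) * y := by group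
      rw [this]
      refine K.mul_mem ?_ hy
      simpa using (inferInstance : K.Normal).conj_mem y⁻¹ (K.inv_mem hy) x⁻¹
  have hrange : f.range = H.map π ⊔ K.map π := by
    rw [← Subgroup.map_sup]
    ext x
    simp [f, π]
  have hcomm : f.range ≤ Subgroup.centralizer f.range := by
    rw [hrange]
    refine sup_le ?_ ?_ <;> rw [Subgroup.le_centralizer_iff] <;> refine sup_le ?_ ?_
    · exact hHH
    · exact Subgroup.le_centralizer_iff.1 hHK
    · exact hHK
    · exact hKK
  have : Group.IsNilpotent f.range := by
    let _ : CommGroup f.range := { (inferInstance : Group f.range) with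
      mul_comm := fun x y => Subtype.ext
        (Subgroup.mem_centralizer_iff.1 (hcomm y.2) x x.2) }
    exact CommGroup.isNilpotent
  refine isNilpotent_of_ker_le_center f.rangeRestrict ?_
  rw [MonoidHom.ker_rangeRestrict]
  intro x hx
  have hx' : (x : G) ∈ H ⊓ K := (QuotientGroup.eq_one_iff _).1 hx
  have hle : H ⊔ K ≤ Subgroup.centralizer {(x : G)} := by
    refine sup_le ?_ ?_ <;> intro y hy <;> rw [Subgroup.mem_centralizer_singleton_iff]
    · exact hH y hy x hx'.1
    · exact hK y hy x hx'.2
  refine Subgroup.mem_center_iff.2 fun y => Subtype.ext ?_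
  exact Subgroup.mem_centralizer_singleton_iff.1 (hle y.2)

/-- The elements of `A` killed by `p` form a normal `p`-subgroup `B` of `G`. As the core is trivial,
`p` is neither `q` nor `r`, so `B` is cyclic with abelian automorphism group. The perfect group `D`
therefore centralizes `B`, and transfer gives the contradiction. -/
theorem Subgroup.eq_bot_of_le_of_isPerfect {q r : ℕ} {G : Type*} [Group G] [Finite G]
    (hcyc : CyclicPSubgroupsAway q r G) (hcore : twoPrimeCore q r G = ⊥) {D A : Subgroup G}
    [Group.IsPerfect D] [A.Normal] (hAD : A ≤ D) (hA : ∀ x ∈ A, ∀ y ∈ A, x * y = y * x) :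
    A = ⊥ := by
  by_contra hne
  obtain ⟨p, hp, hpA⟩ := Nat.exists_prime_and_dvd
    (mt (Subgroup.card_eq_one (H := A)).1 hne)
  have := Fact.mk hp
  let B : Subgroup G :=
    { carrier := {x | x ∈ A ∧ x ^ p = 1}
      one_mem' := ⟨A.one_mem, one_pow p⟩
      mul_mem' := fun {x y} hx hy => ⟨A.mul_mem hx.1 hy.1, by
        rw [Commute.mul_pow (hA x hx.1 y hy.1), hx.2, hy.2, one_mul]⟩
      inv_mem' := fun {x} hx => ⟨A.inv_mem hx.1, by rw [inv_pow, hx.2, inv_one]⟩ }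
  have hBn : B.Normal := ⟨fun x hx y => ⟨(inferInstance : A.Normal).conj_mem x hx.1 y, by
    rw [conj_pow, hx.2, mul_one, mul_inv_cancel]⟩⟩
  have hBp : IsPGroup p B := fun x => ⟨1, Subtype.ext (by
    rw [pow_one]; exact x.2.2)⟩
  obtain ⟨⟨x, hxA⟩, hx⟩ := exists_prime_orderOf_dvd_card' p hpA
  rw [Subgroup.orderOf_mk] at hx
  have hx1 : x ≠ 1 := by
    rintro rfl
    rw [orderOf_one] at hx
    exact hp.one_lt.ne hx
  have hxB : x ∈ B := ⟨hxA, by rw [← hx, pow_orderOf_eq_one]⟩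
  obtain ⟨k, hk⟩ := IsPGroup.iff_card.1 hBp
  have hcoreB : ∀ a b : ℕ, Nat.card B = q ^ a * r ^ b → False := by
    intro a b hab
    have : B ≤ twoPrimeCore q r G := le_sSup ⟨hBn, a, b, hab⟩
    rw [hcore] at this
    exact hx1 (this hxB)
  have hpq : p ≠ q := by rintro rfl; exact hcoreB k 0 (by rw [hk]; simp)
  have hpr : p ≠ r := by rintro rfl; exact hcoreB 0 k (by rw [hk]; simp)
  have hBc : IsCyclic B := hcyc p hp hpq hpr B hBp
  let f : G →* (ZMod (Nat.card B))ˣ :=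
    (IsCyclic.mulAutMulEquiv B).toMonoidHom.comp (MulAut.conjNormal (H := B))
  have hDker : ∀ d ∈ D, ∀ b ∈ B, d * b = b * d := by
    intro d hd b hb
    have h1 : d ∈ _root_.commutator G := by
      have h2 : d ∈ ⁅D, D⁆ := by rwa [Subgroup.commutator_eq_self]
      exact Subgroup.commutator_mono le_top le_top h2
    have h3 : f d = 1 := Abelianization.commutator_subset_ker f h1
    have h4 : MulAut.conjNormal (H := B) d = 1 :=
      (IsCyclic.mulAutMulEquiv B).injective (h3.trans (map_one _).symm)
    have h5 := congrArg Subtype.val (DFunLike.congr_fun h4 ⟨b, hb⟩)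
    rw [MulAut.conjNormal_apply] at h5
    exact mul_inv_eq_iff_eq_mul.1 h5
  have h := Group.IsPerfect.eq_one_of_mem_center_of_pow_eq_one (G := D) (p := p)
    (fun P => hcyc.subgroup D p hp hpq hpr P P.isPGroup') (z := ⟨x, hAD hxA⟩)
    (Subgroup.mem_center_iff.2 fun d => Subtype.ext (hDker d d.2 x hxB))
    (Subtype.ext hxB.2)
  exact hx1 (congrArg Subtype.val h)

/-! ### Minimal normal subgroups. -/

namespace Subgroup

variable {G : Type*} [Group G]

/-- `W` is a minimal nontrivial normal subgroup. -/
def IsMinimalNormal (W : Subgroup G) : Prop :=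
  Minimal (fun N : Subgroup G => N.Normal ∧ N ≠ ⊥) W

theorem exists_isMinimalNormal_le [Finite G] {N : Subgroup G} (hN : N.Normal) (hbot : N ≠ ⊥) :
    ∃ W ≤ N, W.IsMinimalNormal :=
  exists_minimal_le_of_wellFoundedLT (fun N : Subgroup G => N.Normal ∧ N ≠ ⊥) N ⟨hN, hbot⟩

namespace IsMinimalNormal

theorem normal {W : Subgroup G} (hW : W.IsMinimalNormal) : W.Normal := hW.1.1

theorem ne_bot {W : Subgroup G} (hW : W.IsMinimalNormal) : W ≠ ⊥ := hW.1.2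

theorem eq_of_le {W N : Subgroup G} (hW : W.IsMinimalNormal) (hN : N.Normal) (hbot : N ≠ ⊥)
    (hle : N ≤ W) : N = W :=
  le_antisymm hle (hW.2 ⟨hN, hbot⟩ hle)

theorem disjoint {V W : Subgroup G} (hV : V.IsMinimalNormal) (hW : W.IsMinimalNormal)
    (hne : V ≠ W) : Disjoint V W := by
  have := hV.normal
  have := hW.normal
  rw [disjoint_iff]
  by_contra h
  exact hne ((hV.eq_of_le inferInstance h inf_le_left).symm.trans
    (hW.eq_of_le inferInstance h inf_le_right))

theorem commute {V W : Subgroup G} (hV : V.IsMinimalNormal) (hW : W.IsMinimalNormal)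
    (hne : V ≠ W) {x y : G} (hx : x ∈ V) (hy : y ∈ W) : Commute x y :=
  commute_of_normal_of_disjoint V W hV.normal hW.normal (hV.disjoint hW hne) x y hx hy

theorem map_mulEquiv {W : Subgroup G} (hW : W.IsMinimalNormal) (φ : G ≃* G) :
    (W.map φ.toMonoidHom).IsMinimalNormal := by
  have hinj : Function.Injective φ.toMonoidHom := φ.injective
  refine ⟨⟨hW.normal.map _ φ.surjective, fun h => hW.ne_bot ?_⟩, ?_⟩
  · exact (map_eq_bot_iff_of_injective _ hinj).1 h
  · rintro N ⟨hN, hbot⟩ hle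
    have h1 : N.comap φ.toMonoidHom = W := by
      refine hW.eq_of_le inferInstance (fun h => hbot ?_) ?_
      · rw [← map_comap_eq_self_of_surjective (f := φ.toMonoidHom) φ.surjective N, h, map_bot]
      · refine (comap_mono hle).trans_eq ?_
        exact comap_map_eq_self_of_injective hinj W
    rw [← h1]
    exact map_comap_le _ _

/-- Take `S` minimal normal in `W`. A conjugate of `S` different from `S` would commute with it and
meet it trivially, although both orders share a prime outside `q, r`. So `S` is normal in `G`, and
minimality of `W` gives `S = W`. -/
theorem isSimpleGroup [Finite G] {q r : ℕ} (hq : q.Prime) (hr : r.Prime)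
    (hcyc : CyclicPSubgroupsAway q r G) (hcore : twoPrimeCore q r G = ⊥) {W : Subgroup G}
    (hW : W.IsMinimalNormal) : IsSimpleGroup W := by
  have := hW.normal
  have : Nontrivial W := (nontrivial_iff_ne_bot W).2 hW.ne_bot
  refine ⟨fun K hK => or_iff_not_imp_left.2 fun hK0 => ?_⟩
  obtain ⟨S, hSK, hS⟩ := exists_isMinimalNormal_le hK hK0
  have hfix : ∀ x : G, S.map (MulAut.conjNormal (H := W) x).toMonoidHom = S := by
    intro x
    by_contra hne
    have hS' := hS.map_mulEquiv (MulAut.conjNormal (H := W) x)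
    have hcard := card_map_mulEquiv (MulAut.conjNormal (H := W) x) S
    rcases Nat.eq_pow_mul_pow_or_exists_prime q r (n := Nat.card S) Nat.card_pos.ne' with
      ⟨a, b, hab⟩ | ⟨p, hp, hpq, hpr, hpS⟩
    · have hle : S ≤ twoPrimeCore q r W := le_sSup ⟨hS.normal, a, b, hab⟩
      rw [twoPrimeCore_eq_bot_of_normal hq hr hcore W, le_bot_iff] at hle
      exact hS.ne_bot hle
    · exact (hcyc.subgroup W).not_disjoint hp hpq hpr
        (fun x hx y hy => hS'.commute hS hne hx hy) (hcard ▸ hpS) hpS (hS'.disjoint hS hne)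
  have hnormal : (S.map W.subtype).Normal := by
    refine ⟨?_⟩
    rintro _ ⟨y, hy, rfl⟩ x
    have h1 : MulAut.conjNormal (H := W) x y ∈ S := by
      have h2 := hfix x
      exact h2 ▸ mem_map_of_mem (MulAut.conjNormal (H := W) x).toMonoidHom hy
    exact ⟨_, h1, MulAut.conjNormal_apply x y⟩
  have hSW : S.map W.subtype = W := by
    refine hW.eq_of_le hnormal (fun h => hS.ne_bot ?_) (map_subtype_le S)
    exact (map_eq_bot_iff_of_injective _ W.subtype_injective).1 h
  refine top_le_iff.1 (le_trans ?_ hSK)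
  intro y _
  obtain ⟨z, hz, hzy⟩ : (y : G) ∈ S.map W.subtype := hSW.symm ▸ y.2
  rwa [← Subtype.ext hzy]

end IsMinimalNormal

theorem exists_isPerfect_derivedSeries (G : Type*) [Group G] [Finite G] :
    ∃ n, Group.IsPerfect (derivedSeries G n) := by
  obtain ⟨n, hn⟩ := WellFoundedGT.monotone_chain_condition
    (α := (Subgroup G)ᵒᵈ) ⟨derivedSeries G, derivedSeries_antitone G⟩
  refine ⟨n, ?_⟩
  rw [isPerfect_iff]
  exact (hn (n + 1) n.le_succ).symm

theorem isSolvable_quotient_derivedSeries (G : Type*) [Group G] (n : ℕ) :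
    Group.IsSolvable (G ⧸ derivedSeries G n) := by
  refine ⟨⟨n, ?_⟩⟩
  rw [← map_derivedSeries_eq (QuotientGroup.mk'_surjective (derivedSeries G n)) n,
    QuotientGroup.map_mk'_self]

end Subgroup

/-! ### The Fitting subgroup. -/

/-- The Sylow `q`- and `r`-subgroups of a normal nilpotent subgroup are characteristic in it, so
they lie in the trivial core. All its Sylow subgroups are then cyclic, and a nilpotent group with
this property is cyclic. Being abelian, such subgroups have nilpotent joins, so the Fitting subgroup
is itself one of them. -/
theorem isCyclic_fittingSubgroup {q r : ℕ} {M : Type*} [Group M] [Finite M]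
    (hq : q.Prime) (hr : r.Prime)
    (hcyc : CyclicPSubgroupsAway q r M) (hcore : twoPrimeCore q r M = ⊥) :
    IsCyclic (fittingSubgroup M) ∧ ¬ q ∣ Nat.card (fittingSubgroup M) := by
  let S := {N : Subgroup M | N.Normal ∧ Group.IsNilpotent N}
  have hsylow : ∀ N ∈ S, ∀ p : ℕ, p.Prime → (p = q ∨ p = r) → ∀ P : Sylow p N,
      (P : Subgroup N) = ⊥ := by
    rintro N ⟨hN, hnil⟩ p hp hpqr P
    have := Fact.mk hp
    have hPn : (P : Subgroup N).Normal :=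
      Group.isNilpotent_of_finite_tfae.out 0 3 rfl rfl |>.1 hnil p inferInstance P
    have hchar := P.characteristic_of_normal hPn
    obtain ⟨k, hk⟩ := IsPGroup.iff_card.1 P.isPGroup'
    have hle : (P : Subgroup N).map N.subtype ≤ twoPrimeCore q r M := by
      refine le_sSup ⟨inferInstance, ?_⟩
      rw [Subgroup.card_map_of_injective N.subtype_injective, hk]
      rcases hpqr with rfl | rfl
      · exact ⟨k, 0, by simp⟩
      · exact ⟨0, k, by simp⟩
    rw [hcore, le_bot_iff] at hle
    exact (Subgroup.map_eq_bot_iff_of_injective _ N.subtype_injective).1 hle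
  have hcyclic : ∀ N ∈ S, IsCyclic N := by
    intro N hN
    have := hN.2
    have : IsZGroup N := ⟨fun p hp P => by
      by_cases hpqr : p = q ∨ p = r
      · rw [hsylow N hN p hp hpqr P]
        infer_instance
      · push Not at hpqr
        exact hcyc.subgroup N p hp hpqr.1 hpqr.2 P P.isPGroup'⟩
    infer_instance
  have hcommS : ∀ N ∈ S, ∀ x ∈ N, ∀ y ∈ N, x * y = y * x := by
    intro N hN x hx y hy
    have := hcyclic N hN
    exact congrArg Subtype.val (IsMulCommutative.is_comm.comm (⟨x, hx⟩ : N) ⟨y, hy⟩)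
  have hsup : SupClosed S := by
    rintro H hH K hK
    have := hH.1
    have := hK.1
    exact ⟨Subgroup.sup_normal H K,
      Subgroup.isNilpotent_sup_of_isMulCommutative (hcommS H hH) (hcommS K hK)⟩
  have hmem : fittingSubgroup M ∈ S :=
    hsup.sSup_mem_of_nonempty (Set.toFinite _) ⟨⊥, inferInstance, inferInstance⟩ subset_rfl
  refine ⟨hcyclic _ hmem, fun hdvd => ?_⟩
  have := Fact.mk hq
  obtain ⟨P⟩ : Nonempty (Sylow q (fittingSubgroup M)) := inferInstance
  have hP := hsylow _ hmem q hq (Or.inl rfl) P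
  have := P.not_dvd_index
  rw [hP, Subgroup.index_bot] at this
  exact this hdvd

/-! ### From the Euler characteristic to cyclic Sylow subgroups. -/

theorem NatDvdRat.of_int_dvd_two_mul {p : ℕ} (hp : p.Prime) (hp2 : p ≠ 2) {x : ℚ} {k c : ℤ}
    (hk : x = k) (hc : 2 * k = p * c) : NatDvdRat p x := by
  have h2 : IsCoprime (p : ℤ) 2 := by
    have := (Nat.coprime_primes hp Nat.prime_two).2 hp2
    exact_mod_cast Nat.isCoprime_iff_coprime.2 this
  obtain ⟨d, rfl⟩ := h2.dvd_of_dvd_mul_left ⟨c, hc⟩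
  exact ⟨d, by rw [hk]; push_cast; rfl⟩

/-- If an odd prime `p` does not divide the (integral) Euler characteristic, then the Sylow
`p`-subgroups are cyclic. -/
theorem IsTwoMNGroup.isCyclic_sylow {G : Type*} [Group G] [Finite G] {m n : ℕ} {g h : G}
    (hG : IsTwoMNGroup m n g h) (hint : ∃ k : ℤ, twoMNEulerChar G m n = k) {p : ℕ}
    (hp : p.Prime) (hp2 : p ≠ 2) (hndvd : ¬ NatDvdRat p (twoMNEulerChar G m n))
    (P : Sylow p G) : IsCyclic P := by
  have := Fact.mk hp
  obtain ⟨a, ha⟩ := IsPGroup.iff_card.1 P.isPGroup'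
  -- A power of such an `x` generates a Sylow `p`-subgroup, and all of these are isomorphic.
  have key : ∀ x : G, p ^ a ∣ orderOf x → IsCyclic P := by
    rintro x ⟨c, hc⟩
    have hc0 : c ≠ 0 := by rintro rfl; exact (orderOf_pos x).ne' hc
    have ho : orderOf (x ^ c) = p ^ a := by
      rw [orderOf_pow_of_dvd hc0 ⟨p ^ a, by rw [hc, mul_comm]⟩, hc,
        Nat.mul_div_cancel _ (Nat.pos_of_ne_zero hc0)]
    have hcard : Nat.card (Subgroup.zpowers (x ^ c)) = Nat.card P := by
      rw [Nat.card_zpowers, ho, ha]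
    have hpg : IsPGroup p (Subgroup.zpowers (x ^ c)) :=
      IsPGroup.of_card (n := a) (by rw [Nat.card_zpowers, ho])
    obtain ⟨Q, hQ⟩ := hpg.exists_le_sylow
    have hQcard : Nat.card Q = Nat.card P := Nat.card_congr (Sylow.equiv Q P).toEquiv
    have hQeq : Subgroup.zpowers (x ^ c) = Q :=
      Subgroup.eq_of_le_of_card_ge hQ (by rw [hcard]; exact hQcard.le)
    have : IsCyclic Q := by
      rw [← hQeq]; infer_instance
    exact isCyclic_of_surjective _ (Sylow.equiv Q P).surjective
  by_contra hcyc
  rcases Nat.eq_zero_or_pos a with rfl | hapos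
  · exact hcyc (key 1 (by simp))
  have hquot : ∀ x : G, ∃ c : ℕ, Nat.card G = orderOf x * (p * c) := by
    intro x
    obtain ⟨e, he⟩ := orderOf_dvd_natCard x
    by_cases hpe : p ∣ e
    · obtain ⟨c, rfl⟩ := hpe
      exact ⟨c, he⟩
    · refine absurd (key x ?_) hcyc
      have h1 : p ^ a ∣ orderOf x * e := by
        rw [← he, ← ha]; exact Subgroup.card_subgroup_dvd_card _
      refine Nat.Coprime.dvd_of_dvd_mul_right (Nat.Coprime.pow_left a ?_) h1
      exact (Nat.Prime.coprime_iff_not_dvd hp).2 hpe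
  obtain ⟨c, hc⟩ := hquot g
  obtain ⟨d, hd⟩ := hquot h
  -- At the identity this says that `p` divides `|G|` itself, which handles the term `-1/2`.
  obtain ⟨e, he⟩ := hquot 1
  rw [hG.orderOf_left] at hc
  rw [hG.orderOf_right] at hd
  rw [orderOf_one, one_mul] at he
  obtain ⟨k, hk⟩ := hint
  refine hndvd (NatDvdRat.of_int_dvd_two_mul hp hp2 hk (c := 2 * c - e + 2 * d) ?_)
  have hm : (m : ℚ) ≠ 0 := by exact_mod_cast hG.m_pos.ne'
  have hn : (n : ℚ) ≠ 0 := by exact_mod_cast hG.n_pos.ne'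
  have h1 : (Nat.card G : ℚ) * (1 / m) = p * c := by rw [hc]; push_cast; field_simp
  have h2 : (Nat.card G : ℚ) * (1 / n) = p * d := by rw [hd]; push_cast; field_simp
  have h3 : (Nat.card G : ℚ) = p * e := by rw [he]; push_cast; rfl
  have h4 : (2 * k : ℚ) = p * (2 * c - e + 2 * d) := by
    rw [← hk, twoMNEulerChar]
    linear_combination 2 * h1 + 2 * h2 - h3
  exact_mod_cast h4

/-! ### Commuting centerless subgroups and outer automorphisms. -/

namespace Subgroup

variable {G : Type*} [Group G] {ι : Type*} {T : ι → Subgroup G}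

theorem center_eq_bot_of_isSimpleGroup {G : Type*} [Group G] [IsSimpleGroup G]
    (h : ¬ ∀ x y : G, x * y = y * x) : center G = ⊥ := by
  refine (inferInstance : (center G).Normal).eq_bot_or_eq_top.resolve_right fun htop => h ?_
  exact fun x y => mem_center_iff.1 (htop ▸ mem_top y : y ∈ center G) x

theorem disjoint_of_commute {H K : Subgroup G} (hH : center H = ⊥)
    (hHK : ∀ x ∈ H, ∀ y ∈ K, Commute x y) : Disjoint H K := by
  rw [disjoint_def]
  intro x hxH hxK
  have : (⟨x, hxH⟩ : H) ∈ center H :=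
    mem_center_iff.2 fun y => Subtype.ext (hHK y y.2 x hxK)
  rw [hH, mem_bot] at this
  exact congrArg Subtype.val this

theorem iSupIndep_of_commute (hT : ∀ i, center (T i) = ⊥)
    (hcomm : Pairwise fun i j => ∀ x y : G, x ∈ T i → y ∈ T j → Commute x y) :
    iSupIndep T := by
  intro i
  refine disjoint_of_commute (hT i) fun x hx y hy => ?_
  have hle : ⨆ j, ⨆ (_ : j ≠ i), T j ≤ centralizer {x} := by
    refine iSup₂_le fun j hj z hz => ?_
    rw [mem_centralizer_singleton_iff]
    exact hcomm hj z x hz hx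
  exact (mem_centralizer_singleton_iff.1 (hle hy)).symm

/-- If `E` is a normal subgroup with trivial center, isomorphic to `H`, then `G` modulo
`C(E) * E` embeds into `Out(H)`. -/
theorem exists_injective_outerAut {H : Type*} [Group H] (E : Subgroup G) [E.Normal]
    (φ : H ≃* E) (N : Subgroup G) [N.Normal] (hN : N = centralizer E ⊔ E) :
    ∃ f : G ⧸ N →* OuterAut H, Function.Injective f := by
  let F : G →* OuterAut H := (QuotientGroup.mk' _).comp
    ((MulAut.congr φ.symm).toMonoidHom.comp (MulAut.conjNormal (H := E)))
  have hker : N = F.ker := by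
    have hmem : ∀ x : G, x ∈ F.ker ↔ ∃ t : H, ∀ y : E, (φ t : G) * y * (φ t : G)⁻¹ =
        x * y * x⁻¹ := by
      intro x
      have h1 : x ∈ F.ker ↔ (MulAut.congr φ.symm) (MulAut.conjNormal (H := E) x) ∈
          (MulAut.conj : H →* MulAut H).range := QuotientGroup.eq_one_iff _
      rw [h1]
      refine exists_congr fun t => ?_
      constructor
      · intro h y
        have h2 := DFunLike.congr_fun h (φ.symm y)
        have h3 := congrArg (fun z => (φ z : G)) h2
        simpa [MulAut.congr] using h3
      · intro h
        ext y
        apply φ.injective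
        apply Subtype.ext
        simpa [MulAut.congr] using h (φ y)
    rw [hN]
    apply le_antisymm
    · refine sup_le (fun x hx => (hmem x).2 ⟨1, fun y => ?_⟩) fun x hx =>
        (hmem x).2 ⟨φ.symm ⟨x, hx⟩, fun y => ?_⟩
      · rw [← mem_centralizer_iff.1 hx y y.2]
        simp
      · simp
    · intro x hx
      obtain ⟨t, ht⟩ := (hmem x).1 hx
      -- If `x` acts on `E` as the inner automorphism of `φ t`, then the two differ by an element
      -- centralizing `E`.
      have h1 : x * (φ t : G)⁻¹ ∈ centralizer (E : Set G) := by
        refine mem_centralizer_iff.2 fun y hy => ?_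
        have h2 := ht ⟨(φ t : G)⁻¹ * y * φ t,
          E.mul_mem (E.mul_mem (E.inv_mem (φ t).2) hy) (φ t).2⟩
        have h3 : y = x * ((φ t : G)⁻¹ * y * φ t) * x⁻¹ := by
          rw [← h2]; group
        calc y * (x * (φ t : G)⁻¹)
            = x * ((φ t : G)⁻¹ * y * φ t) * x⁻¹ * (x * (φ t : G)⁻¹) := by rw [← h3]
          _ = x * (φ t : G)⁻¹ * y := by group
      have h2 := mul_mem_sup h1 (φ t).2
      rwa [inv_mul_cancel_right] at h2
  exact ⟨(QuotientGroup.kerLift F).comp (QuotientGroup.quotientMulEquivOfEq hker).toMonoidHom,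
    (QuotientGroup.kerLift_injective F).comp (QuotientGroup.quotientMulEquivOfEq hker).injective⟩

end Subgroup

/-! ### Assembling the decomposition. -/

/-- Structure of a nonsolvable finite group with trivial `O_{q,r}` and cyclic Sylow `p`-subgroups
for all other primes `p`. -/
theorem CyclicPSubgroupsAway.exists_normal_mulEquiv_prod {q r : ℕ} {G : Type u} [Group G]
    [Finite G] (hcyc : CyclicPSubgroupsAway q r G) (hq : q.Prime) (hr : r.Prime)
    (hcore : twoPrimeCore q r G = ⊥) (hns : ¬ Group.IsSolvable G) :
    ∃ (k : ℕ) (M : Type u) (_ : Group M) (T : Fin k → Type u) (_ : ∀ i, Group (T i))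
      (N : Subgroup G) (_ : N.Normal),
      0 < k ∧
      Nonempty (N ≃* M × (∀ i, T i)) ∧
      Group.IsSolvable M ∧
      IsCyclic (fittingSubgroup M) ∧
      ¬ q ∣ Nat.card (fittingSubgroup M) ∧
      (∀ i, IsSimpleGroup (T i) ∧ ¬ ∀ x y : T i, x * y = y * x) ∧
      (∀ i j, i ≠ j → ∃ a b : ℕ, Nat.gcd (Nat.card (T i)) (Nat.card (T j)) = q ^ a * r ^ b) ∧
      ∃ f : G ⧸ N →* OuterAut (∀ i, T i), Function.Injective f := by
  obtain ⟨n, hperf⟩ := Subgroup.exists_isPerfect_derivedSeries G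
  set D := derivedSeries G n with hD
  have hDn : D.Normal := derivedSeries_normal G n
  have hDbot : D ≠ ⊥ := fun h => hns ⟨⟨n, h⟩⟩
  let ι := {W : Subgroup G // W.IsMinimalNormal ∧ W ≤ D}
  let e : Fin (Nat.card ι) ≃ ι := (Finite.equivFin ι).symm
  let T : Fin (Nat.card ι) → Subgroup G := fun i => (e i).1
  have hTmin : ∀ i, (T i).IsMinimalNormal := fun i => (e i).2.1
  have hTD : ∀ i, T i ≤ D := fun i => (e i).2.2
  have hTn : ∀ i, (T i).Normal := fun i => (hTmin i).normal
  have hTinj : ∀ i j, i ≠ j → T i ≠ T j := fun i j hij h => hij (e.injective (Subtype.ext h))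
  have hTsimple : ∀ i, IsSimpleGroup (T i) := fun i =>
    (hTmin i).isSimpleGroup hq hr hcyc hcore
  have hTcomm : ∀ i, ¬ ∀ x y : T i, x * y = y * x := fun i h =>
    (hTmin i).ne_bot (Subgroup.eq_bot_of_le_of_isPerfect hcyc hcore (hTD i)
      fun x hx y hy => congrArg Subtype.val (h ⟨x, hx⟩ ⟨y, hy⟩))
  have hTcenter : ∀ i, Subgroup.center (T i) = ⊥ := fun i =>
    Subgroup.center_eq_bot_of_isSimpleGroup (hTcomm i)
  have hpair : Pairwise fun i j => ∀ x y : G, x ∈ T i → y ∈ T j → Commute x y :=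
    fun i j hij x y hx hy => (hTmin i).commute (hTmin j) (hTinj i j hij) hx hy
  let φ := Subgroup.noncommPiCoprod hpair
  have hφinj : Function.Injective φ := Subgroup.injective_noncommPiCoprod_of_iSupIndep
    (Subgroup.iSupIndep_of_commute hTcenter hpair)
  let E : Subgroup G := φ.range
  have hE : E = ⨆ i, T i := Subgroup.noncommPiCoprod_range
  have hEn : E.Normal := by
    rw [hE, iSup]
    refine sSup_normal_of_forall _ ?_
    rintro _ ⟨i, rfl⟩
    exact hTn i
  have hTE : ∀ i, T i ≤ E := fun i => hE ▸ le_iSup T i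
  have hED : E ≤ D := hE ▸ iSup_le hTD
  let M : Subgroup G := Subgroup.centralizer (E : Set G)
  -- A minimal normal subgroup inside `M ⊓ D` would be one of the `T i`; lying also in the
  -- centralizer of `E`, it would be abelian.
  have hMD : M ⊓ D = ⊥ := by
    by_contra h
    obtain ⟨W, hWle, hW⟩ := Subgroup.exists_isMinimalNormal_le
      (inferInstance : (M ⊓ D).Normal) h
    obtain ⟨i, hi⟩ := e.surjective ⟨W, hW, hWle.trans inf_le_right⟩
    have hTi : T i = W := congrArg Subtype.val hi
    refine hTcomm i fun x y => Subtype.ext ?_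
    have hx : (x : G) ∈ M := (hWle (hTi ▸ x.2)).1
    exact (Subgroup.mem_centralizer_iff.1 hx y (hTE i y.2)).symm
  have hME : Disjoint M E := disjoint_iff.2 (le_bot_iff.1 ((inf_le_inf_left M hED).trans hMD.le))
  have hMsolv : Group.IsSolvable M := by
    have := Subgroup.isSolvable_quotient_derivedSeries G n
    refine Group.isSolvable_of_isSolvable_injective
      (f := (QuotientGroup.mk' D).comp M.subtype) ?_
    rw [injective_iff_map_eq_one]
    intro x hx
    have hxD : (x : G) ∈ D := (QuotientGroup.eq_one_iff _).1 hx
    have : (x : G) ∈ M ⊓ D := ⟨x.2, hxD⟩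
    rw [hMD] at this
    exact Subtype.ext this
  have hMfit := isCyclic_fittingSubgroup hq hr (hcyc.subgroup M)
    (twoPrimeCore_eq_bot_of_normal hq hr hcore M)
  let ψ : M × (∀ i, T i) →* G := MonoidHom.noncommCoprod M.subtype φ fun x y =>
    (Subgroup.mem_centralizer_iff.1 x.2 (φ y) ⟨y, rfl⟩).symm
  have hψ : Function.Injective ψ := by
    refine (MonoidHom.noncommCoprod_injective _ _ _).2 ⟨M.subtype_injective, hφinj, ?_⟩
    rwa [Subgroup.range_subtype]
  have hψrange : ψ.range = M ⊔ E := by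
    refine (MonoidHom.noncommCoprod_range _ _ _).trans ?_
    rw [Subgroup.range_subtype]
  have hNn : ψ.range.Normal := by rw [hψrange]; infer_instance
  refine ⟨Nat.card ι, M, inferInstance, fun i => T i, fun i => inferInstance, ψ.range, hNn, ?_,
    ⟨(MonoidHom.ofInjective hψ).symm⟩, hMsolv, hMfit.1, hMfit.2,
    fun i => ⟨hTsimple i, hTcomm i⟩, ?_, ?_⟩
  · obtain ⟨W, hWD, hW⟩ := Subgroup.exists_isMinimalNormal_le hDn hDbot
    have : Nonempty ι := ⟨⟨W, hW, hWD⟩⟩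
    exact Nat.card_pos
  · intro i j hij
    refine (Nat.eq_pow_mul_pow_or_exists_prime q r
      (Nat.gcd_pos_of_pos_left _ Nat.card_pos).ne').resolve_right ?_
    rintro ⟨p, hp, hpq, hpr, hdvd⟩
    exact hcyc.not_disjoint hp hpq hpr (fun x hx y hy => hpair hij x y hx hy)
      (hdvd.trans (Nat.gcd_dvd_left _ _)) (hdvd.trans (Nat.gcd_dvd_right _ _))
      ((hTmin i).disjoint (hTmin j) (hTinj i j hij))
  · exact E.exists_injective_outerAut (MonoidHom.ofInjective hφinj) ψ.range hψrange

theorem proposition4p1 {G : Type u} [Group G] [Finite G] (m n s : ℕ) (g h : G)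
    (hG : IsTwoMNGroup m n g h) (hns : ¬ Group.IsSolvable G)
    (hs : s.Prime) (hs2 : s ≠ 2)
    (hχ : ∀ p : ℕ, p.Prime → (NatDvdRat p (twoMNEulerChar G m n) ↔ p = 2 ∨ p = s)) :
    ∃ (k : ℕ) (M : Type u) (_ : Group M) (T : Fin k → Type u) (_ : ∀ i, Group (T i))
      (N : Subgroup (G ⧸ twoPrimeCore 2 s G)) (_ : N.Normal),
      0 < k ∧
      Nonempty (N ≃* M × (∀ i, T i)) ∧
      Group.IsSolvable M ∧
      IsCyclic (fittingSubgroup M) ∧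
      Odd (Nat.card (fittingSubgroup M)) ∧
      (∀ i, IsSimpleGroup (T i) ∧ ¬ ∀ x y : T i, x * y = y * x) ∧
      (∀ i j, i ≠ j → ∃ a b : ℕ, Nat.gcd (Nat.card (T i)) (Nat.card (T j)) = 2 ^ a * s ^ b) ∧
      ∃ f : (G ⧸ twoPrimeCore 2 s G) ⧸ N →* OuterAut (∀ i, T i), Function.Injective f := by
  -- Integrality of `χ` is part of its divisibility by 2.
  have hint : ∃ k : ℤ, twoMNEulerChar G m n = k := by
    obtain ⟨k, hk⟩ := (hχ 2 Nat.prime_two).2 (Or.inl rfl)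
    exact ⟨2 * k, by rw [hk]; push_cast; rfl⟩
  have hcyc : CyclicPSubgroupsAway 2 s G := CyclicPSubgroupsAway.of_sylow
    fun p hp hp2 hps P => hG.isCyclic_sylow hint hp hp2
      (fun hd => ((hχ p hp).1 hd).elim hp2 hps) P
  obtain ⟨a, b, hab⟩ := (twoPrimeCore_isGreatest Nat.prime_two hs G).1.2
  have hsolv := Group.isSolvable_of_card_eq_prime_pow_mul_prime_pow Nat.prime_two hs _ hab
  have hns' : ¬ Group.IsSolvable (G ⧸ twoPrimeCore 2 s G) := fun h =>
    hns ((Group.isSolvable_iff_subgroup_quotient (twoPrimeCore 2 s G)).2 ⟨hsolv, h⟩)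
  obtain ⟨k, M, _, T, _, N, hN, h1, h2, h3, h4, h5, h6⟩ :=
    (hcyc.quotient (twoPrimeCore 2 s G)).exists_normal_mulEquiv_prod Nat.prime_two hs
      (twoPrimeCore_quotient Nat.prime_two hs G) hns'
  exact ⟨k, M, _, T, _, N, hN, h1, h2, h3, h4,
    Nat.not_even_iff_odd.1 fun he => h5 he.two_dvd, h6⟩
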